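/- Write a permutation $\sigma\in S_n$ as a product of disjoint cycles (fixed points included), each cycle written $C=(c_0,\dots,c_{p-1})$ with $c_0$ its smallest element and $\sigma(c_r)=c_{r+1}$, indices modulo $p$. For $\tau=\tau_1\cdots\tau_j\in S_j$ (one-line notation), $\tau$ *cycle occurs* in $\sigma$ if some cycle of $\sigma$ has length $p\ge j$ and there are $0\le r\le p-1$ and $0<i_1<\dots<i_{j-1}\le p-1$ such that the word $c_r\,c_{r+i_1}\cdots c_{r+i_{j-1}}$ (indices modulo $p$) is in the same relative order as $\tau_1\cdots\tau_j$; otherwise $\sigma$ *cycle avoids* $\tau$. Let $\mathcal{CAS}_n(\tau)$ be the set of $\sigma\in S_n$ that cycle avoid $\tau$, let $\mathrm{cyc}(\sigma)$ be the number of cycles of $\sigma$, put $\mathrm{cdes}(C)=1+|\{0\le r<p-1: c_r>c_{r+1}\}|$, and let $\mathrm{cdes}(\sigma)$ be the sum of $\mathrm{cdes}(C)$ over all cycles $C$ of $\sigma$. Define $$CA_\tau(t)=1+\sum_{n\ge1}|\mathcal{CAS}_n(\tau)|\frac{t^n}{n!},\qquad CA_\tau(t,x)=1+\sum_{n\ge1}\frac{t^n}{n!}\sum_{\sigma\in\mathcal{CAS}_n(\tau)}x^{\mathrm{cyc}(\sigma)},$$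 $$CA_\tau(t,x,y)=1+\sum_{n\ge1}\frac{t^n}{n!}\sum_{\sigma\in\mathcal{CAS}_n(\tau)}x^{\mathrm{cyc}(\sigma)}y^{\mathrm{cdes}(\sigma)}.$$ The following identities hold as formal power series in $t$ over any commutative $\mathbb{Q}$-algebra $R$, with $x,y\in R$, and $y$ invertible in (2) (for example $R=\mathbb{Q}[x,y,y^{-1}]$ with $x,y$ indeterminates). (1) For every $\tau\in S_3$, $CA_\tau(t)=e^{e^t-1}$ and $CA_\tau(t,x)=e^{x(e^t-1)}$. (2) $CA_{123}(t,x,y)=CA_{312}(t,x,y)=CA_{231}(t,x,y)=\exp\!\left(x\left(yt+\frac{1}{y}\left(e^{yt}-1-yt\right)\right)\right)$. (3) $CA_{132}(t,x,y)=CA_{213}(t,x,y)=CA_{321}(t,x,y)=e^{xy(e^t-1)}$. (4) For every $m\ge3$, the only $m$-cycle in $S_m$ that cycle avoids any given one of $123,312,231$ is $(1,m,m-1,\dots,2)$, and the only $m$-cycle in $S_m$ that cycle avoids any given one of $132,213,321$ is $(1,2,\dots,m)$. -/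

import Mathlib

open PowerSeries

namespace CyclePattern

/-! Permutations of `{1, …, n}` are modelled as `Equiv.Perm (Fin n)` (all letters shifted by one).
The cycle of `σ` with smallest element `a` is `(a, σ a, σ² a, …, σ^(p-1) a)`, where `p` is the number
of elements of the cycle, so its entry `c_r` (with `r` read modulo `p`) is `(σ ^ r) a`. -/

section Cycles

variable {n : ℕ}

/-- The set of smallest elements of the cycles of `σ` (fixed points are cycles of length one). -/
def cycleMins (σ : Equiv.Perm (Fin n)) : Finset (Fin n) :=
  Finset.univ.filter fun a => ∀ b, σ.SameCycle a b → a ≤ b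

/-- The length of the cycle of `σ` that contains `a`. -/
def cycleLen (σ : Equiv.Perm (Fin n)) (a : Fin n) : ℕ :=
  (Finset.univ.filter fun b => σ.SameCycle a b).card

/-- The number of cycles of `σ`, fixed points included. -/
def cyc (σ : Equiv.Perm (Fin n)) : ℕ := (cycleMins σ).card

/-- One plus the number of descents of the word `c_0 c_1 … c_{p-1}`, `c_r = (σ ^ r) a`;
this is `cdes` of the cycle of `σ` whose smallest element is `a`. -/
def cdesCycle (σ : Equiv.Perm (Fin n)) (a : Fin n) : ℕ :=
  1 + ((Finset.range (cycleLen σ a - 1)).filter fun r => (σ ^ (r + 1)) a < (σ ^ r) a).card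

/-- The sum of `cdes` over all cycles of `σ`. -/
def cdes (σ : Equiv.Perm (Fin n)) : ℕ := ∑ a ∈ cycleMins σ, cdesCycle σ a

/-- The word `w` has distinct letters and its reduction is the permutation `τ`
(written in one-line notation `τ 0, τ 1, …`). -/
def ReducesTo {j : ℕ} (w : Fin j → Fin n) (τ : Equiv.Perm (Fin j)) : Prop :=
  ∀ s t, w s < w t ↔ τ s < τ t

/-- `τ` cycle occurs in `σ`: in some cycle `(c_0, …, c_{p-1})` of `σ` with `j ≤ p` there are a
start `r` and offsets `0 = i 0 < i 1 < … < i (j-1) ≤ p - 1` such that the word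
`c_{r + i 0} c_{r + i 1} … c_{r + i (j-1)}` (indices modulo `p`) reduces to `τ`. -/
def CycleOccurs {j : ℕ} (τ : Equiv.Perm (Fin j)) (σ : Equiv.Perm (Fin n)) : Prop :=
  ∃ a ∈ cycleMins σ, j ≤ cycleLen σ a ∧
    ∃ r < cycleLen σ a, ∃ i : Fin j → ℕ,
      (∀ s : Fin j, (s : ℕ) = 0 → i s = 0) ∧ StrictMono i ∧ (∀ s, i s < cycleLen σ a) ∧
      ReducesTo (fun s => (σ ^ (r + i s)) a) τ

/-- `σ` cycle avoids `τ`. -/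
def CycleAvoids {j : ℕ} (τ : Equiv.Perm (Fin j)) (σ : Equiv.Perm (Fin n)) : Prop :=
  ¬ CycleOccurs τ σ

end Cycles

open scoped Classical in
/-- The set of permutations in `S_n` that cycle avoid `τ`. -/
noncomputable def CAS {j : ℕ} (n : ℕ) (τ : Equiv.Perm (Fin j)) : Finset (Equiv.Perm (Fin n)) :=
  Finset.univ.filter fun σ => CycleAvoids τ σ

section GeneratingFunctions

variable (R : Type*) [CommRing R] [Algebra ℚ R]

/-- `CA_τ(t) = 1 + ∑_{n ≥ 1} |CAS_n(τ)| t^n / n!`, a power series in `t`. -/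
noncomputable def CA1 {j : ℕ} (τ : Equiv.Perm (Fin j)) : R⟦X⟧ :=
  PowerSeries.mk fun n =>
    if n = 0 then 1 else algebraMap ℚ R (1 / (n.factorial : ℚ)) * ((CAS n τ).card : R)

variable {R}

/-- `CA_τ(t,x) = 1 + ∑_{n ≥ 1} (t^n / n!) ∑_{σ ∈ CAS_n(τ)} x^{cyc σ}`, a power series in `t`. -/
noncomputable def CA2 {j : ℕ} (τ : Equiv.Perm (Fin j)) (x : R) : R⟦X⟧ :=
  PowerSeries.mk fun n =>
    if n = 0 then 1 else algebraMap ℚ R (1 / (n.factorial : ℚ)) * ∑ σ ∈ CAS n τ, x ^ cyc σ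

/-- `CA_τ(t,x,y) = 1 + ∑_{n ≥ 1} (t^n / n!) ∑_{σ ∈ CAS_n(τ)} x^{cyc σ} y^{cdes σ}`,
a power series in `t`. -/
noncomputable def CA3 {j : ℕ} (τ : Equiv.Perm (Fin j)) (x y : R) : R⟦X⟧ :=
  PowerSeries.mk fun n =>
    if n = 0 then 1
    else algebraMap ℚ R (1 / (n.factorial : ℚ)) * ∑ σ ∈ CAS n τ, x ^ cyc σ * y ^ cdes σ

/-- `e^F`, the exponential series composed with `F`; only used for `F` with constant term zero,
where the composition is the usual one. -/
noncomputable def expOf (F : R⟦X⟧) : R⟦X⟧ := (PowerSeries.exp R).subst F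

end GeneratingFunctions

/-! The six permutations in `S_3`, given by one-line notation and inverse. -/

def p123 : Equiv.Perm (Fin 3) := ⟨![0, 1, 2], ![0, 1, 2], by decide, by decide⟩
def p132 : Equiv.Perm (Fin 3) := ⟨![0, 2, 1], ![0, 2, 1], by decide, by decide⟩
def p213 : Equiv.Perm (Fin 3) := ⟨![1, 0, 2], ![1, 0, 2], by decide, by decide⟩
def p231 : Equiv.Perm (Fin 3) := ⟨![1, 2, 0], ![2, 0, 1], by decide, by decide⟩
def p312 : Equiv.Perm (Fin 3) := ⟨![2, 0, 1], ![1, 2, 0], by decide, by decide⟩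
def p321 : Equiv.Perm (Fin 3) := ⟨![2, 1, 0], ![2, 1, 0], by decide, by decide⟩

end CyclePattern

/-! Changing the starting point of a cycle rotates the patterns read from it, so the rotations 123,
312, 231 impose one condition on a cycle and the rotations 132, 321, 213 another. Placing the
minimum of the cycle as the smallest letter turns these conditions into statements about pairs: a
cycle avoids the second class exactly when it increases from its minimum (`cycleAvoids_iff_isIncr`),
and the first exactly when it decreases after its minimum (`cycleAvoids_iff_isDecr`). Each block of
a set partition therefore carries exactly one admissible cycle (`IsIncr.ext`, `nextPerm`; the
decreasing case follows by inversion, `isIncr_inv`). The generating functions become sums over set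
partitions with a weight `g k` for each block of size `k`, and the exponential formula
`partitionWeight_eq` evaluates them. With both statistics the weight is `x * y` for an increasing
cycle; for a decreasing one it is `x * y ^ (k - 1)` if `k ≥ 2` and `x * y` if `k = 1`. The claim
about `m`-cycles is the case of a single block. -/

namespace CyclePattern

/-! ### The exponential formula for set partitions. -/

section ExponentialFormula

variable {α : Type*} [DecidableEq α] {R : Type*} [CommRing R]

/-- The total weight of the set partitions of `s`, a block with `k` elements having weight `g k`. -/
def partitionWeight (g : ℕ → R) (s : Finset α) : R :=
  ∑ P : Finpartition s, ∏ B ∈ P.parts, g B.card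

theorem partitionWeight_empty (g : ℕ → R) : partitionWeight g (∅ : Finset α) = 1 := by
  have : ∀ P : Finpartition (∅ : Finset α), P.parts = ∅ := fun P => P.parts_eq_empty_iff.2 rfl
  have hu : (Finset.univ : Finset (Finpartition (∅ : Finset α))) = {Finpartition.empty _} := by
    ext P
    simp only [Finset.mem_univ, Finset.mem_singleton, true_iff]
    exact Finpartition.ext ((this _).trans (this _).symm)
  rw [partitionWeight, hu, Finset.sum_singleton, this, Finset.prod_empty]

/-- Partitions of `insert a s` in which the block of `a` is `insert a B` are partitions of
`s \ B`. -/
theorem sum_finpartition_part_eq (g : ℕ → R) {a : α} {s B : Finset α} (ha : a ∉ s) (hB : B ⊆ s) :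
    ∑ P : Finpartition (insert a s) with P.part a = insert a B, ∏ C ∈ P.parts, g C.card =
      g (B.card + 1) * partitionWeight g (s \ B) := by
  have haB : a ∉ B := fun h => ha (hB h)
  have hdisj : Disjoint (s \ B) (insert a B) := by
    rw [Finset.disjoint_left]; intro x hx hx'
    rw [Finset.mem_sdiff] at hx
    rcases Finset.mem_insert.1 hx' with rfl | h
    · exact ha hx.1
    · exact hx.2 h
  have hsup : (s \ B) ⊔ insert a B = insert a s := by
    ext x
    simp only [Finset.sup_eq_union, Finset.mem_union, Finset.mem_sdiff, Finset.mem_insert]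
    have := @hB x
    tauto
  have hne : insert a B ≠ ⊥ := Finset.insert_ne_empty _ _
  rw [partitionWeight, Finset.mul_sum]
  symm
  have hmem : ∀ Q : Finpartition (s \ B), insert a B ∉ Q.parts := fun Q h =>
    hne (hdisj.symm.eq_bot_of_le (Q.le h))
  refine Finset.sum_bij (fun Q _ => Q.extend hne hdisj hsup) ?_ ?_ ?_ ?_
  · intro Q _
    rw [Finset.mem_filter]
    refine ⟨Finset.mem_univ _, Finpartition.part_eq_of_mem _ ?_ (Finset.mem_insert_self _ _)⟩
    simp
  · intro Q _ Q' _ h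
    have h' := congrArg (fun P => P.parts.erase (insert a B)) h
    simp only [Finpartition.extend_parts] at h'
    rw [Finset.erase_insert (hmem Q), Finset.erase_insert (hmem Q')] at h'
    exact Finpartition.ext h'
  · intro P hP
    rw [Finset.mem_filter] at hP
    have hBP : insert a B ∈ P.parts := by
      rw [← hP.2, Finpartition.part_mem]; exact Finset.mem_insert_self _ _
    have hs : (P.parts.erase (insert a B)).sup id = s \ B := by
      ext x
      simp only [Finset.mem_sup, Finset.mem_erase, id]
      constructor
      · rintro ⟨C, ⟨hC, hCP⟩, hx⟩
        have h1 := P.le hCP hx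
        have h2 : x ∉ insert a B := fun h => hC (P.eq_of_mem_parts hCP hBP hx h)
        rw [Finset.mem_insert] at h1 h2
        rw [Finset.mem_sdiff]
        tauto
      · intro hx
        rw [Finset.mem_sdiff] at hx
        obtain ⟨C, hC, hxC⟩ := P.exists_mem (Finset.mem_insert_of_mem hx.1)
        refine ⟨C, ⟨?_, hC⟩, hxC⟩
        rintro rfl
        rcases Finset.mem_insert.1 hxC with rfl | h
        · exact ha hx.1
        · exact hx.2 h
    refine ⟨P.ofSubset (Finset.erase_subset (insert a B) _) hs, Finset.mem_univ _, ?_⟩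
    apply Finpartition.ext
    simp [Finset.insert_erase hBP]
  · intro Q _
    rw [Finpartition.extend_parts, Finset.prod_insert (hmem Q), Finset.card_insert_of_notMem haB]

/-- Sorting partitions by the block of `a`, with `a` removed, gives the recurrence that the
coefficients of the exponential also satisfy. -/
theorem partitionWeight_insert (g : ℕ → R) {a : α} {s : Finset α} (ha : a ∉ s) :
    partitionWeight g (insert a s) =
      ∑ B ∈ s.powerset, g (B.card + 1) * partitionWeight g (s \ B) := by
  rw [partitionWeight, ← Finset.sum_fiberwise_of_maps_to
    (g := fun P : Finpartition (insert a s) => (P.part a).erase a) (t := s.powerset)]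
  · refine Finset.sum_congr rfl fun B hB => ?_
    rw [Finset.mem_powerset] at hB
    rw [← sum_finpartition_part_eq g ha hB]
    refine Finset.sum_congr (Finset.filter_congr fun P _ => ?_) fun _ _ => rfl
    have h1 : a ∈ P.part a := P.mem_part_self.2 (Finset.mem_insert_self _ _)
    have h2 : a ∉ B := fun h => ha (hB h)
    constructor
    · intro h; rw [← h, Finset.insert_erase h1]
    · intro h; rw [h, Finset.erase_insert h2]
  · intro P _
    rw [Finset.mem_powerset, ← Finset.subset_insert_iff]
    exact P.part_subset a

variable [Algebra ℚ R]

/-- The exponential generating function of the weights of nonempty blocks. -/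
noncomputable def blockSeries (g : ℕ → R) : R⟦X⟧ :=
  PowerSeries.mk fun k => if k = 0 then 0 else algebraMap ℚ R (1 / (k.factorial : ℚ)) * g k

theorem hasSubst_blockSeries (g : ℕ → R) : HasSubst (blockSeries g) := by
  apply HasSubst.of_constantCoeff_zero'
  rw [← coeff_zero_eq_constantCoeff_apply, blockSeries, coeff_mk, if_pos rfl]

theorem derivative_expOf {F : R⟦X⟧} (hF : HasSubst F) :
    derivative R (expOf F) = expOf F * derivative R F := by
  rw [expOf, derivative_subst hF, derivative_exp]

theorem factorial_mul_coeff_blockSeries (g : ℕ → R) (i : ℕ) :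
    ((i.factorial : ℕ) : R) * coeff i (derivative R (blockSeries g)) = g (i + 1) := by
  have h : ((i + 1).factorial : ℚ) ≠ 0 := by positivity
  have h2 : (((i + 1).factorial : ℕ) : R) * algebraMap ℚ R (1 / ((i + 1).factorial : ℚ)) = 1 := by
    rw [← map_natCast (algebraMap ℚ R), ← map_mul, mul_one_div_cancel h, map_one]
  rw [coeff_derivative, blockSeries, coeff_mk, if_neg (Nat.succ_ne_zero i)]
  rw [Nat.factorial_succ] at h2 ⊢
  push_cast at h2 ⊢
  linear_combination (g (i + 1)) * h2

/-- Compare coefficients in `(e^F)' = F' e^F`. The binomial coefficient counts the sets `B` of size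
`k` in `partitionWeight_insert`. -/
theorem factorial_mul_coeff_expOf_succ (g : ℕ → R) (n : ℕ) :
    (((n + 1).factorial : ℕ) : R) * coeff (n + 1) (expOf (blockSeries g)) =
      ∑ k ∈ Finset.range (n + 1), n.choose k •
        (g (k + 1) * (((n - k).factorial : ℕ) * coeff (n - k) (expOf (blockSeries g)))) := by
  have h := congrArg (coeff n) (derivative_expOf (hasSubst_blockSeries g))
  rw [coeff_derivative, mul_comm (expOf _), coeff_mul,
    Finset.Nat.sum_antidiagonal_eq_sum_range_succ_mk] at h
  rw [Nat.factorial_succ]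
  push_cast
  have : ((n : R) + 1) * (n.factorial : R) * coeff (n + 1) (expOf (blockSeries g)) =
    (n.factorial : R) * (coeff (n + 1) (expOf (blockSeries g)) * ((n : R) + 1)) := by ring
  rw [this, h, Finset.mul_sum]
  refine Finset.sum_congr rfl fun k hk => ?_
  have hk' : k ≤ n := Nat.lt_succ_iff.1 (Finset.mem_range.1 hk)
  rw [← factorial_mul_coeff_blockSeries g k, ← Nat.choose_mul_factorial_mul_factorial hk', nsmul_eq_mul]
  push_cast
  ring

/-- The exponential formula for set partitions. -/
theorem partitionWeight_eq (g : ℕ → R) (s : Finset α) :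
    partitionWeight g s = (s.card.factorial : R) * coeff s.card (expOf (blockSeries g)) := by
  induction hn : s.card using Nat.strong_induction_on generalizing s with
  | _ n ih =>
    rcases s.eq_empty_or_nonempty with rfl | ⟨a, ha⟩
    · have h0 : (blockSeries g).constantCoeff = 0 := by
        rw [← coeff_zero_eq_constantCoeff_apply, blockSeries, coeff_mk, if_pos rfl]
      rw [Finset.card_empty] at hn
      subst hn
      rw [partitionWeight_empty, coeff_zero_eq_constantCoeff_apply, expOf]
      -- The vanishing criterion needs a zero constant term, so it is applied to `exp - 1` and the 1
      -- is restored afterwards.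
      have := constantCoeff_subst_eq_zero h0 (PowerSeries.exp R - 1) (by simp)
      rw [subst_sub (hasSubst_blockSeries g)] at this
      have h1 : (1 : R⟦X⟧).subst (blockSeries g) = (1 : R⟦X⟧) := by
        rw [← coe_substAlgHom (hasSubst_blockSeries g), map_one]
      rw [h1] at this
      have h2 : constantCoeff ((PowerSeries.exp R).subst (blockSeries g)) - 1 = (0 : R) := by
        rw [← map_one (constantCoeff (R := R)), ← map_sub]; exact this
      rw [sub_eq_zero.1 h2]; simp
    · obtain ⟨t, hat, rfl⟩ : ∃ t, a ∉ t ∧ insert a t = s :=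
        ⟨s.erase a, Finset.notMem_erase _ _, Finset.insert_erase ha⟩
      rw [Finset.card_insert_of_notMem hat] at hn
      subst hn
      rw [partitionWeight_insert g hat, factorial_mul_coeff_expOf_succ,
        ← Finset.sum_powerset_apply_card (fun k => g (k + 1) *
          (((t.card - k).factorial : ℕ) * coeff (t.card - k) (expOf (blockSeries g))))]
      refine Finset.sum_congr rfl fun B hB => ?_
      have hB' := Finset.mem_powerset.1 hB
      rw [ih (t.card - B.card) (by omega) (t \ B) (Finset.card_sdiff_of_subset hB')]

end ExponentialFormula

/-! ### Cycles as words starting at their minimum. -/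

section CycleWords

variable {n : ℕ}

/-- The set of elements of the cycle of `σ` that contains `a`. -/
def cycleSet (σ : Equiv.Perm (Fin n)) (a : Fin n) : Finset (Fin n) :=
  Finset.univ.filter fun b => σ.SameCycle a b

theorem mem_cycleSet {σ : Equiv.Perm (Fin n)} {a b : Fin n} :
    b ∈ cycleSet σ a ↔ σ.SameCycle a b := by simp [cycleSet]

theorem card_cycleSet (σ : Equiv.Perm (Fin n)) (a : Fin n) :
    (cycleSet σ a).card = cycleLen σ a := rfl

theorem mem_cycleMins {σ : Equiv.Perm (Fin n)} {a : Fin n} :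
    a ∈ cycleMins σ ↔ ∀ b, σ.SameCycle a b → a ≤ b := by simp [cycleMins]

theorem self_mem_cycleSet (σ : Equiv.Perm (Fin n)) (a : Fin n) : a ∈ cycleSet σ a :=
  mem_cycleSet.2 (Equiv.Perm.SameCycle.refl _ _)

theorem cycleLen_pos (σ : Equiv.Perm (Fin n)) (a : Fin n) : 0 < cycleLen σ a :=
  Finset.card_pos.2 ⟨a, self_mem_cycleSet σ a⟩

theorem isCycleOn_cycleSet (σ : Equiv.Perm (Fin n)) (a : Fin n) :
    σ.IsCycleOn (cycleSet σ a : Set (Fin n)) := by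
  refine ⟨σ.bijOn fun b => ?_, fun b hb c hc => ?_⟩
  · simp only [Finset.mem_coe, mem_cycleSet, Equiv.Perm.sameCycle_apply_right]
  · exact (mem_cycleSet.1 hb).symm.trans (mem_cycleSet.1 hc)

theorem pow_apply_inj {σ : Equiv.Perm (Fin n)} {a : Fin n} {r s : ℕ} (hr : r < cycleLen σ a)
    (hs : s < cycleLen σ a) (h : (σ ^ r) a = (σ ^ s) a) : r = s :=
  Nat.ModEq.eq_of_lt_of_lt
    (((isCycleOn_cycleSet σ a).pow_apply_eq_pow_apply (self_mem_cycleSet σ a)).1 h) hr hs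

theorem pow_cycleLen_apply (σ : Equiv.Perm (Fin n)) (a : Fin n) :
    (σ ^ cycleLen σ a) a = a :=
  (isCycleOn_cycleSet σ a).pow_card_apply (self_mem_cycleSet σ a)

theorem pow_add_cycleLen_apply (σ : Equiv.Perm (Fin n)) (a : Fin n) (r : ℕ) :
    (σ ^ (r + cycleLen σ a)) a = (σ ^ r) a := by
  rw [pow_add, Equiv.Perm.mul_apply, pow_cycleLen_apply]

theorem exists_pow_apply_eq {σ : Equiv.Perm (Fin n)} {a b : Fin n} (h : σ.SameCycle a b) :
    ∃ r < cycleLen σ a, (σ ^ r) a = b :=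
  (isCycleOn_cycleSet σ a).exists_pow_eq (self_mem_cycleSet σ a) (mem_cycleSet.2 h)

theorem exists_cycleMin (σ : Equiv.Perm (Fin n)) (b : Fin n) :
    ∃ a ∈ cycleMins σ, σ.SameCycle a b := by
  obtain ⟨a, ha, hmin⟩ := (cycleSet σ b).exists_min_image id ⟨b, self_mem_cycleSet σ b⟩
  have hba := mem_cycleSet.1 ha
  exact ⟨a, mem_cycleMins.2 fun c hc => hmin c (mem_cycleSet.2 (hba.trans hc)), hba.symm⟩

theorem lt_pow_apply_of_mem_cycleMins {σ : Equiv.Perm (Fin n)} {a : Fin n} (ha : a ∈ cycleMins σ)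
    {r : ℕ} (h0 : 0 < r) (hr : r < cycleLen σ a) : a < (σ ^ r) a := by
  refine lt_of_le_of_ne
    (mem_cycleMins.1 ha _ (Equiv.Perm.sameCycle_pow_right.2 (Equiv.Perm.SameCycle.refl _ _)))
    fun h => ?_
  have := pow_apply_inj (cycleLen_pos σ a) hr h
  omega

/-- Every cycle of `σ`, written from its smallest element, is increasing. -/
def IsIncr (σ : Equiv.Perm (Fin n)) : Prop :=
  ∀ a ∈ cycleMins σ, ∀ r s, r < s → s < cycleLen σ a → (σ ^ r) a < (σ ^ s) a

/-- Every cycle of `σ`, written from its smallest element, is decreasing after this element. -/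
def IsDecr (σ : Equiv.Perm (Fin n)) : Prop :=
  ∀ a ∈ cycleMins σ, ∀ r s, 0 < r → r < s → s < cycleLen σ a → (σ ^ s) a < (σ ^ r) a

theorem cycleMins_inv (σ : Equiv.Perm (Fin n)) : cycleMins σ⁻¹ = cycleMins σ := by
  ext a
  simp only [mem_cycleMins, Equiv.Perm.sameCycle_inv]

theorem cycleLen_inv (σ : Equiv.Perm (Fin n)) (a : Fin n) : cycleLen σ⁻¹ a = cycleLen σ a := by
  simp only [cycleLen, Equiv.Perm.sameCycle_inv]

theorem inv_pow_apply (σ : Equiv.Perm (Fin n)) (a : Fin n) {r : ℕ} (hr : r ≤ cycleLen σ a) :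
    (σ⁻¹ ^ r) a = (σ ^ (cycleLen σ a - r)) a := by
  rw [inv_pow, Equiv.Perm.inv_eq_iff_eq, ← Equiv.Perm.mul_apply, ← pow_add,
    Nat.add_sub_cancel' hr, pow_cycleLen_apply]

/-- Inversion keeps the minimum of each cycle in front and reverses the rest of the word. -/
theorem isIncr_inv (σ : Equiv.Perm (Fin n)) : IsIncr σ⁻¹ ↔ IsDecr σ := by
  simp only [IsIncr, IsDecr, cycleMins_inv, cycleLen_inv]
  refine forall₂_congr fun a ha => ⟨fun h r s h0 hrs hs => ?_, fun h r s hrs hs => ?_⟩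
  · have := h (cycleLen σ a - s) (cycleLen σ a - r) (by omega) (by omega)
    rwa [inv_pow_apply σ a (by omega), inv_pow_apply σ a (by omega),
      Nat.sub_sub_self (by omega), Nat.sub_sub_self (by omega)] at this
  · rcases Nat.eq_zero_or_pos r with rfl | h0
    · rw [pow_zero, Equiv.Perm.one_apply, inv_pow_apply σ a (by omega)]
      exact lt_pow_apply_of_mem_cycleMins ha (by omega) (by omega)
    · rw [inv_pow_apply σ a (by omega), inv_pow_apply σ a (by omega)]
      exact h _ _ (by omega) (by omega) (by omega)

/-- A permutation with increasing cycles is determined by its cycle partition. -/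
theorem IsIncr.ext {σ τ : Equiv.Perm (Fin n)} (hσ : IsIncr σ) (hτ : IsIncr τ)
    (h : ∀ a b, σ.SameCycle a b ↔ τ.SameCycle a b) : σ = τ := by
  have hset : ∀ a, cycleSet σ a = cycleSet τ a := fun a => by
    ext b; simp only [mem_cycleSet, h]
  have hlen : ∀ a, cycleLen σ a = cycleLen τ a := fun a => congrArg Finset.card (hset a)
  have hmin : ∀ a, a ∈ cycleMins σ ↔ a ∈ cycleMins τ := fun a => by simp only [mem_cycleMins, h]
  have key : ∀ a ∈ cycleMins σ, ∀ r < cycleLen σ a, (σ ^ r) a = (τ ^ r) a := by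
    intro a ha r hr
    -- Both words enumerate the same finite set increasingly, and such an enumeration is unique.
    have h1 := Finset.orderEmbOfFin_unique (card_cycleSet σ a)
      (f := fun r : Fin (cycleLen σ a) => (σ ^ (r : ℕ)) a)
      (fun r => by simp [mem_cycleSet, Equiv.Perm.SameCycle.refl]) (fun r s hrs => hσ a ha r s hrs s.2)
    have h2 := Finset.orderEmbOfFin_unique (card_cycleSet σ a)
      (f := fun r : Fin (cycleLen σ a) => (τ ^ (r : ℕ)) a)
      (fun r => by rw [hset]; simp [mem_cycleSet, Equiv.Perm.SameCycle.refl])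
      (fun r s hrs => hτ a ((hmin a).1 ha) r s hrs (by rw [← hlen]; exact s.2))
    exact congrFun (h1.trans h2.symm) ⟨r, hr⟩
  ext1 b
  obtain ⟨a, ha, hab⟩ := exists_cycleMin σ b
  obtain ⟨r, hr, rfl⟩ := exists_pow_apply_eq hab
  rw [← Equiv.Perm.mul_apply, ← pow_succ', key a ha r hr, ← Equiv.Perm.mul_apply, ← pow_succ']
  rcases Nat.lt_or_ge (r + 1) (cycleLen σ a) with h1 | h1
  · exact key a ha _ h1
  · have h2 : r + 1 = cycleLen σ a := by omega
    rw [h2, pow_cycleLen_apply, hlen, pow_cycleLen_apply]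

/-- The set partition into the cycles of `σ`. -/
def cyclePartition (σ : Equiv.Perm (Fin n)) : Finpartition (Finset.univ : Finset (Fin n)) :=
  @Finpartition.ofSetoid _ _ _ (Equiv.Perm.SameCycle.setoid σ)
    (fun a b => inferInstanceAs (Decidable (σ.SameCycle a b)))

theorem parts_cyclePartition (σ : Equiv.Perm (Fin n)) :
    (cyclePartition σ).parts = Finset.univ.image (cycleSet σ) := rfl

theorem mem_part_cyclePartition {σ : Equiv.Perm (Fin n)} {a b : Fin n} :
    b ∈ (cyclePartition σ).part a ↔ σ.SameCycle a b :=
  @Finpartition.mem_part_ofSetoid_iff_rel _ _ a _ (Equiv.Perm.SameCycle.setoid σ)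
    (fun a b => inferInstanceAs (Decidable (σ.SameCycle a b))) b

/-- Each cycle contains exactly one minimum, so the minima index the blocks bijectively. -/
theorem prod_parts_cyclePartition {R : Type*} [CommRing R] (g : ℕ → R) (σ : Equiv.Perm (Fin n)) :
    ∏ B ∈ (cyclePartition σ).parts, g B.card = ∏ a ∈ cycleMins σ, g (cycleLen σ a) := by
  have himg : (cyclePartition σ).parts = (cycleMins σ).image (cycleSet σ) := by
    rw [parts_cyclePartition]
    refine le_antisymm (fun B hB => ?_) (Finset.image_subset_image (Finset.subset_univ _))
    obtain ⟨b, -, rfl⟩ := Finset.mem_image.1 hB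
    obtain ⟨a, ha, hab⟩ := exists_cycleMin σ b
    refine Finset.mem_image.2 ⟨a, ha, ?_⟩
    ext c
    rw [mem_cycleSet, mem_cycleSet]
    exact ⟨hab.symm.trans, hab.trans⟩
  rw [himg, Finset.prod_image]
  · rfl
  · intro a ha b hb hab
    have hsc : σ.SameCycle a b := by
      rw [← mem_cycleSet, hab]; exact self_mem_cycleSet σ b
    exact le_antisymm (mem_cycleMins.1 ha b hsc) (mem_cycleMins.1 hb a hsc.symm)

end CycleWords

/-! ### The permutation with increasing cycles attached to a set partition. -/

section NextPerm

variable {n : ℕ} (P : Finpartition (Finset.univ : Finset (Fin n)))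

/-- The cyclic shift of the sorted block of `P` that contains `b`. -/
def blockPerm (b : Fin n) : Equiv.Perm (Fin n) := (P.part b).sort.formPerm

theorem part_eq_part_of_mem {b c : Fin n} (h : c ∈ P.part b) : P.part c = P.part b :=
  P.part_eq_of_mem (P.part_mem.2 (Finset.mem_univ _)) h

theorem blockPerm_mem_part {b c : Fin n} : blockPerm P b c ∈ P.part b ↔ c ∈ P.part b := by
  rw [← Finset.mem_sort (α := Fin n) (· ≤ ·), ← Finset.mem_sort (α := Fin n) (· ≤ ·)]
  exact List.formPerm_mem_iff_mem

theorem blockPerm_congr {b c : Fin n} (h : c ∈ P.part b) : blockPerm P c = blockPerm P b := by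
  rw [blockPerm, part_eq_part_of_mem P h, blockPerm]

theorem self_mem_part (b : Fin n) : b ∈ P.part b := P.mem_part_self.2 (Finset.mem_univ _)

/-- The permutation with increasing cycles whose cycle partition is `P`. -/
def nextPerm : Equiv.Perm (Fin n) where
  toFun b := blockPerm P b b
  invFun b := (blockPerm P b).symm b
  left_inv b := by
    dsimp only
    rw [blockPerm_congr P ((blockPerm_mem_part P).2 (self_mem_part P b)),
      Equiv.symm_apply_apply]
  right_inv b := by
    dsimp only
    rw [blockPerm_congr P (b := b), Equiv.apply_symm_apply]
    rw [← blockPerm_mem_part, Equiv.apply_symm_apply]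
    exact self_mem_part P b

theorem nextPerm_pow_apply (b : Fin n) (k : ℕ) :
    (nextPerm P ^ k) b = (blockPerm P b ^ k) b ∧ (nextPerm P ^ k) b ∈ P.part b := by
  induction k with
  | zero => exact ⟨rfl, self_mem_part P b⟩
  | succ k ih =>
    have h : (nextPerm P ^ (k + 1)) b = blockPerm P b ((nextPerm P ^ k) b) := by
      rw [pow_succ', Equiv.Perm.mul_apply, ← blockPerm_congr P ih.2]; rfl
    refine ⟨?_, ?_⟩
    · rw [h, ih.1, pow_succ', Equiv.Perm.mul_apply]
    · rw [h, blockPerm_mem_part]; exact ih.2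

theorem nextPerm_pow_getElem (b : Fin n) (k i : ℕ) (hi : i < (P.part b).sort.length)
    (hb : (P.part b).sort[i] = b) :
    (nextPerm P ^ k) b = (P.part b).sort[(i + k) % (P.part b).sort.length]'
      (Nat.mod_lt _ (i.zero_le.trans_lt hi)) := by
  have h := List.formPerm_pow_apply_getElem (P.part b).sort (Finset.sort_nodup _ _) k i hi
  rw [← h, hb]
  exact (nextPerm_pow_apply P b k).1

theorem sameCycle_nextPerm {b c : Fin n} : (nextPerm P).SameCycle b c ↔ c ∈ P.part b := by
  constructor
  · intro h
    obtain ⟨k, -, rfl⟩ := exists_pow_apply_eq h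
    exact (nextPerm_pow_apply P b k).2
  · intro hc
    obtain ⟨i, hi, hib⟩ := List.getElem_of_mem ((Finset.mem_sort (· ≤ ·)).2 (self_mem_part P b))
    obtain ⟨j, hj, hjc⟩ := List.getElem_of_mem ((Finset.mem_sort (· ≤ ·)).2 hc)
    -- Going from index `i` to index `j` by way of the end of the list keeps the exponent natural
    -- even when `j < i`.
    refine ⟨((j + ((P.part b).sort.length - i) : ℕ) : ℤ), ?_⟩
    rw [zpow_natCast, nextPerm_pow_getElem P b _ i hi hib, ← hjc]
    congr 1
    have h : ∀ p, i < p → i + (j + (p - i)) = j + p := by omega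
    rw [h _ hi, Nat.add_mod_right, Nat.mod_eq_of_lt hj]

theorem isIncr_nextPerm : IsIncr (nextPerm P) := by
  intro a ha r s hrs hs
  have hset : cycleSet (nextPerm P) a = P.part a := by
    ext b; rw [mem_cycleSet, sameCycle_nextPerm]
  have hlen : (P.part a).sort.length = cycleLen (nextPerm P) a := by
    rw [Finset.length_sort, ← hset, card_cycleSet]
  obtain ⟨i, hi, hia⟩ := List.getElem_of_mem ((Finset.mem_sort (· ≤ ·)).2 (self_mem_part P a))
  have hsorted := (Finset.sortedLT_sort (P.part a)).strictMono_get
  -- The minimum of the cycle heads its sorted block, so exponents below the length never wrap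
  -- around.
  have hi0 : i = 0 := by
    by_contra h0
    have h1 : (P.part a).sort[0]'(by omega) < (P.part a).sort[i] :=
      @hsorted ⟨0, by omega⟩ ⟨i, hi⟩ (by simpa using Nat.pos_of_ne_zero h0)
    rw [hia] at h1
    refine absurd (mem_cycleMins.1 ha _ ?_) (not_le.2 h1)
    rw [sameCycle_nextPerm, ← Finset.mem_sort (α := Fin n) (· ≤ ·)]
    exact List.getElem_mem _
  subst hi0
  rw [nextPerm_pow_getElem P a r 0 hi hia, nextPerm_pow_getElem P a s 0 hi hia]
  refine @hsorted ⟨_, _⟩ ⟨_, _⟩ ?_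
  rw [Fin.mk_lt_mk, Nat.zero_add, Nat.zero_add, Nat.mod_eq_of_lt (by omega),
    Nat.mod_eq_of_lt (by omega)]
  exact hrs

theorem cyclePartition_nextPerm : cyclePartition (nextPerm P) = P := by
  apply Finpartition.ext
  rw [parts_cyclePartition]
  have : cycleSet (nextPerm P) = P.part := by
    ext a b; rw [mem_cycleSet, sameCycle_nextPerm]
  rw [this]
  ext B
  simp only [Finset.mem_image, Finset.mem_univ, true_and]
  constructor
  · rintro ⟨a, rfl⟩; exact P.part_mem.2 (Finset.mem_univ _)
  · intro hB
    obtain ⟨a, ha⟩ := P.nonempty_of_mem_parts hB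
    exact ⟨a, P.part_eq_of_mem hB ha⟩

end NextPerm

/-! ### Sums over monotone-cycle permutations as sums over set partitions. -/

section Sums

variable {n : ℕ} {R : Type*} [CommRing R]

open scoped Classical in
theorem sum_isIncr (g : ℕ → R) :
    ∑ σ : Equiv.Perm (Fin n) with IsIncr σ, ∏ a ∈ cycleMins σ, g (cycleLen σ a) =
      partitionWeight g (Finset.univ : Finset (Fin n)) := by
  rw [partitionWeight]
  refine Finset.sum_bij (fun σ _ => cyclePartition σ) (fun _ _ => Finset.mem_univ _) ?_ ?_ ?_
  · intro σ hσ τ hτ h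
    refine (Finset.mem_filter.1 hσ).2.ext (Finset.mem_filter.1 hτ).2 fun a b => ?_
    rw [← mem_part_cyclePartition, h, mem_part_cyclePartition]
  · intro P _
    exact ⟨nextPerm P, Finset.mem_filter.2 ⟨Finset.mem_univ _, isIncr_nextPerm P⟩,
      cyclePartition_nextPerm P⟩
  · intro σ _
    exact (prod_parts_cyclePartition g σ).symm

open scoped Classical in
theorem sum_isDecr (g : ℕ → R) :
    ∑ σ : Equiv.Perm (Fin n) with IsDecr σ, ∏ a ∈ cycleMins σ, g (cycleLen σ a) =
      partitionWeight g (Finset.univ : Finset (Fin n)) := by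
  rw [← sum_isIncr]
  refine Finset.sum_equiv (Equiv.inv _) (fun σ => ?_) fun σ _ => ?_
  · simp [isIncr_inv]
  · simp [cycleMins_inv, cycleLen_inv]

end Sums

/-! ### Avoidance of three-letter patterns, and the statistics of avoiders. -/

section Avoidance

variable {n : ℕ}

/-- Listing the positions by increasing value of `τ` turns the pattern into one chain of
inequalities. -/
theorem reducesTo_iff_strictMono {j : ℕ} (w : Fin j → Fin n) (τ : Equiv.Perm (Fin j)) :
    ReducesTo w τ ↔ StrictMono (w ∘ τ.symm) := by
  constructor
  · intro h s t hst
    exact (h _ _).2 (by simpa using hst)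
  · intro h s t
    simpa using h.lt_iff_lt (a := τ s) (b := τ t)

theorem strictMono_fin_three {α : Type*} [Preorder α] (f : Fin 3 → α) :
    StrictMono f ↔ f 0 < f 1 ∧ f 1 < f 2 := by
  rw [Fin.strictMono_iff_lt_succ, Fin.forall_fin_two]
  rfl

theorem cycleOccurs_iff (τ : Equiv.Perm (Fin 3)) (σ : Equiv.Perm (Fin n)) :
    CycleOccurs τ σ ↔ ∃ a ∈ cycleMins σ, ∃ r i k, r < cycleLen σ a ∧ 0 < i ∧ i < k ∧
      k < cycleLen σ a ∧ StrictMono (![(σ ^ r) a, (σ ^ (r + i)) a, (σ ^ (r + k)) a] ∘ τ.symm) := by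
  constructor
  · rintro ⟨a, ha, -, r, hr, i, h0, hi, hlt, hw⟩
    rw [strictMono_fin_three, h0 0 rfl] at hi
    refine ⟨a, ha, r, i 1, i 2, hr, hi.1, hi.2, hlt 2, ?_⟩
    rw [reducesTo_iff_strictMono] at hw
    convert! hw using 2
    ext s
    fin_cases s <;> simp [h0 0 rfl]
  · rintro ⟨a, ha, r, i, k, hr, hi, hik, hk, hw⟩
    refine ⟨a, ha, by omega, r, hr, ![0, i, k], ?_, ?_, ?_, ?_⟩
    · intro s hs
      obtain rfl : s = 0 := Fin.ext hs
      rfl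
    · rw [strictMono_fin_three]; exact ⟨hi, hik⟩
    · intro s
      fin_cases s
      · exact cycleLen_pos σ a
      · exact hik.trans hk
      · exact hk
    · rw [reducesTo_iff_strictMono]
      convert! hw using 2
      ext s
      fin_cases s <;> simp

/-- A start and an offset each below the length have sum below twice the length, so one subtraction
reduces the index modulo the length. -/
theorem pow_apply_eq_pow_ite (σ : Equiv.Perm (Fin n)) (a : Fin n) (m : ℕ) :
    (σ ^ m) a = (σ ^ (if m < cycleLen σ a then m else m - cycleLen σ a)) a := by
  split_ifs with h
  · rfl
  · rw [← pow_add_cycleLen_apply σ a (m - _), Nat.sub_add_cancel (not_lt.1 h)]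

theorem IsIncr.pow_lt_pow_iff {σ : Equiv.Perm (Fin n)} (h : IsIncr σ) {a : Fin n}
    (ha : a ∈ cycleMins σ) {r s : ℕ} (hr : r < cycleLen σ a) (hs : s < cycleLen σ a) :
    (σ ^ r) a < (σ ^ s) a ↔ r < s := by
  refine ⟨fun hlt => ?_, fun hrs => h a ha r s hrs hs⟩
  by_contra hsr
  rcases (not_lt.1 hsr).lt_or_eq with h' | rfl
  · exact lt_asymm hlt (h a ha s r h' hr)
  · exact lt_irrefl _ hlt

theorem IsDecr.pow_lt_pow_iff {σ : Equiv.Perm (Fin n)} (h : IsDecr σ) {a : Fin n}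
    (ha : a ∈ cycleMins σ) {r s : ℕ} (hr : r < cycleLen σ a) (hs : s < cycleLen σ a) :
    (σ ^ r) a < (σ ^ s) a ↔ (r = 0 ∧ 0 < s) ∨ (0 < s ∧ s < r) := by
  have h0 : ∀ t, 0 < t → t < cycleLen σ a → (σ ^ 0) a < (σ ^ t) a := fun t ht ht' =>
    lt_pow_apply_of_mem_cycleMins ha ht ht'
  constructor
  · intro hlt
    by_contra hc
    have hcases : r = s ∨ (s = 0 ∧ 0 < r) ∨ (0 < r ∧ r < s) := by omega
    rcases hcases with rfl | ⟨rfl, hr0⟩ | ⟨hr0, hrs⟩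
    · exact lt_irrefl _ hlt
    · exact lt_asymm hlt (h0 r hr0 hr)
    · exact lt_asymm hlt (h a ha r s hr0 hrs hs)
  · rintro (⟨rfl, hs0⟩ | ⟨hs0, hsr⟩)
    · exact h0 s hs0 hs
    · exact h a ha s r hs0 hsr hr

theorem strictMono_comp_p123 (x y z : Fin n) :
    StrictMono (![x, y, z] ∘ p123.symm) ↔ x < y ∧ y < z := strictMono_fin_three _

theorem strictMono_comp_p132 (x y z : Fin n) :
    StrictMono (![x, y, z] ∘ p132.symm) ↔ x < z ∧ z < y := strictMono_fin_three _

theorem strictMono_comp_p213 (x y z : Fin n) :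
    StrictMono (![x, y, z] ∘ p213.symm) ↔ y < x ∧ x < z := strictMono_fin_three _

theorem strictMono_comp_p231 (x y z : Fin n) :
    StrictMono (![x, y, z] ∘ p231.symm) ↔ z < x ∧ x < y := strictMono_fin_three _

theorem strictMono_comp_p312 (x y z : Fin n) :
    StrictMono (![x, y, z] ∘ p312.symm) ↔ y < z ∧ z < x := strictMono_fin_three _

theorem strictMono_comp_p321 (x y z : Fin n) :
    StrictMono (![x, y, z] ∘ p321.symm) ↔ z < y ∧ y < x := strictMono_fin_three _

theorem pow_add_sub_apply (σ : Equiv.Perm (Fin n)) (a : Fin n) {r s : ℕ} (hr : r ≤ cycleLen σ a) :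
    (σ ^ (r + (cycleLen σ a - r + s))) a = (σ ^ s) a := by
  rw [show r + (cycleLen σ a - r + s) = s + cycleLen σ a by omega, pow_add_cycleLen_apply]

/-- If `v < w` is an inverted pair of positions, then `c_0 c_v c_w` is a 132, `c_w c_0 c_v` a 213
and `c_v c_w c_0` a 321. Conversely, three letters read around an increasing cycle form a rotation
of 123. -/
theorem cycleAvoids_iff_isIncr {τ : Equiv.Perm (Fin 3)}
    (hτ : τ ∈ ({p132, p213, p321} : Set (Equiv.Perm (Fin 3)))) (σ : Equiv.Perm (Fin n)) :
    CycleAvoids τ σ ↔ IsIncr σ := by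
  rw [CycleAvoids, cycleOccurs_iff]
  constructor
  · intro h a ha v w hvw hw
    rcases Nat.eq_zero_or_pos v with rfl | hv
    · exact lt_pow_apply_of_mem_cycleMins ha hvw hw
    by_contra hlt
    have hne : (σ ^ w) a ≠ (σ ^ v) a := fun he => hvw.ne' (pow_apply_inj hw (hvw.trans hw) he)
    have hlt' : (σ ^ w) a < (σ ^ v) a := lt_of_le_of_ne (not_lt.1 hlt) hne
    have h0 : (σ ^ 0) a < (σ ^ w) a := lt_pow_apply_of_mem_cycleMins ha (hv.trans hvw) hw
    have hp := cycleLen_pos σ a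
    rcases hτ with rfl | rfl | rfl
    · refine h ⟨a, ha, 0, v, w, hp, hv, hvw, hw, ?_⟩
      rw [strictMono_comp_p132, Nat.zero_add, Nat.zero_add]
      exact ⟨h0, hlt'⟩
    -- The offset `cycleLen σ a - w` carries the start `w` around to `c_0`.
    · refine h ⟨a, ha, w, cycleLen σ a - w + 0, cycleLen σ a - w + v, hw, by omega, by omega,
        by omega, ?_⟩
      rw [strictMono_comp_p213, pow_add_sub_apply σ a hw.le, pow_add_sub_apply σ a hw.le]
      exact ⟨h0, hlt'⟩
    · refine h ⟨a, ha, v, w - v, cycleLen σ a - v + 0, by omega, by omega, by omega,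
        by omega, ?_⟩
      rw [strictMono_comp_p321, pow_add_sub_apply σ a (by omega), Nat.add_sub_cancel' hvw.le]
      exact ⟨h0, hlt'⟩
  · rintro h ⟨a, ha, r, i, k, hr, hi, hik, hk, hw⟩
    rw [pow_apply_eq_pow_ite σ a (r + i), pow_apply_eq_pow_ite σ a (r + k)] at hw
    rcases hτ with rfl | rfl | rfl
    · rw [strictMono_comp_p132, h.pow_lt_pow_iff ha hr (by split_ifs <;> omega),
        h.pow_lt_pow_iff ha (by split_ifs <;> omega) (by split_ifs <;> omega)] at hw
      split_ifs at hw <;> omega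
    · rw [strictMono_comp_p213, h.pow_lt_pow_iff ha (by split_ifs <;> omega) hr,
        h.pow_lt_pow_iff ha hr (by split_ifs <;> omega)] at hw
      split_ifs at hw <;> omega
    · rw [strictMono_comp_p321, h.pow_lt_pow_iff ha (by split_ifs <;> omega)
        (by split_ifs <;> omega), h.pow_lt_pow_iff ha (by split_ifs <;> omega) hr] at hw
      split_ifs at hw <;> omega

/-- For `0 < v < w` with `c_v < c_w`, the words `c_0 c_v c_w`, `c_w c_0 c_v` and `c_v c_w c_0` are a
123, a 312 and a 231. Conversely, three letters read around a decreasing cycle form a rotation of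
321. -/
theorem cycleAvoids_iff_isDecr {τ : Equiv.Perm (Fin 3)}
    (hτ : τ ∈ ({p123, p312, p231} : Set (Equiv.Perm (Fin 3)))) (σ : Equiv.Perm (Fin n)) :
    CycleAvoids τ σ ↔ IsDecr σ := by
  rw [CycleAvoids, cycleOccurs_iff]
  constructor
  · intro h a ha v w hv hvw hw
    by_contra hlt
    have hne : (σ ^ v) a ≠ (σ ^ w) a := fun he => hvw.ne (pow_apply_inj (hvw.trans hw) hw he)
    have hlt' : (σ ^ v) a < (σ ^ w) a := lt_of_le_of_ne (not_lt.1 hlt) hne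
    have h0 : (σ ^ 0) a < (σ ^ v) a := lt_pow_apply_of_mem_cycleMins ha hv (hvw.trans hw)
    have hp := cycleLen_pos σ a
    rcases hτ with rfl | rfl | rfl
    · refine h ⟨a, ha, 0, v, w, hp, hv, hvw, hw, ?_⟩
      rw [strictMono_comp_p123, Nat.zero_add, Nat.zero_add]
      exact ⟨h0, hlt'⟩
    · refine h ⟨a, ha, w, cycleLen σ a - w + 0, cycleLen σ a - w + v, hw, by omega, by omega,
        by omega, ?_⟩
      rw [strictMono_comp_p312, pow_add_sub_apply σ a hw.le, pow_add_sub_apply σ a hw.le]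
      exact ⟨h0, hlt'⟩
    · refine h ⟨a, ha, v, w - v, cycleLen σ a - v + 0, by omega, by omega, by omega,
        by omega, ?_⟩
      rw [strictMono_comp_p231, pow_add_sub_apply σ a (by omega), Nat.add_sub_cancel' hvw.le]
      exact ⟨h0, hlt'⟩
  · rintro h ⟨a, ha, r, i, k, hr, hi, hik, hk, hw⟩
    rw [pow_apply_eq_pow_ite σ a (r + i), pow_apply_eq_pow_ite σ a (r + k)] at hw
    rcases hτ with rfl | rfl | rfl
    · rw [strictMono_comp_p123, h.pow_lt_pow_iff ha hr (by split_ifs <;> omega),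
        h.pow_lt_pow_iff ha (by split_ifs <;> omega) (by split_ifs <;> omega)] at hw
      split_ifs at hw <;> omega
    · rw [strictMono_comp_p312, h.pow_lt_pow_iff ha (by split_ifs <;> omega)
        (by split_ifs <;> omega), h.pow_lt_pow_iff ha (by split_ifs <;> omega) hr] at hw
      split_ifs at hw <;> omega
    · rw [strictMono_comp_p231, h.pow_lt_pow_iff ha (by split_ifs <;> omega) hr,
        h.pow_lt_pow_iff ha hr (by split_ifs <;> omega)] at hw
      split_ifs at hw <;> omega

theorem mem_even_or_mem_odd (τ : Equiv.Perm (Fin 3)) :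
    τ ∈ ({p123, p312, p231} : Set (Equiv.Perm (Fin 3))) ∨
      τ ∈ ({p132, p213, p321} : Set (Equiv.Perm (Fin 3))) := by
  simp only [Set.mem_insert_iff, Set.mem_singleton_iff]
  revert τ
  decide

theorem IsIncr.cdesCycle_eq {σ : Equiv.Perm (Fin n)} (h : IsIncr σ) {a : Fin n}
    (ha : a ∈ cycleMins σ) : cdesCycle σ a = 1 := by
  rw [cdesCycle, Finset.filter_false_of_mem, Finset.card_empty]
  intro r hr
  rw [Finset.mem_range] at hr
  exact lt_asymm (h a ha r (r + 1) (by omega) (by omega))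

/-- The word `c_0 < c_1 > c_2 > ⋯ > c_{p-1}` has `p - 2` descents when `p ≥ 2`. A fixed point still
contributes the added 1. -/
theorem IsDecr.cdesCycle_eq {σ : Equiv.Perm (Fin n)} (h : IsDecr σ) {a : Fin n}
    (ha : a ∈ cycleMins σ) :
    cdesCycle σ a = if cycleLen σ a = 1 then 1 else cycleLen σ a - 1 := by
  have hp := cycleLen_pos σ a
  have : ((Finset.range (cycleLen σ a - 1)).filter fun r => (σ ^ (r + 1)) a < (σ ^ r) a) =
      (Finset.range (cycleLen σ a - 1)).erase 0 := by
    ext r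
    rw [Finset.mem_filter, Finset.mem_erase, Finset.mem_range, and_comm]
    refine and_congr_left fun hr => ?_
    rw [h.pow_lt_pow_iff ha (by omega) (by omega)]
    omega
  rw [cdesCycle, this]
  split_ifs with h1
  · rw [h1]; rfl
  · rw [Finset.card_erase_of_mem (Finset.mem_range.2 (by omega)), Finset.card_range]
    omega

theorem pow_cyc_mul_pow_cdes {R : Type*} [CommRing R] (x y : R) (σ : Equiv.Perm (Fin n)) :
    x ^ cyc σ * y ^ cdes σ = ∏ a ∈ cycleMins σ, x * y ^ cdesCycle σ a := by
  rw [Finset.prod_mul_distrib, Finset.prod_const, Finset.prod_pow_eq_pow_sum, cyc, cdes]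

theorem finRotate_pow_zero (k r : ℕ) (hr : r < k + 1) :
    (((finRotate (k + 1)) ^ r) 0 : Fin (k + 1)).val = r := by
  induction r with
  | zero => rfl
  | succ r ih =>
    rw [pow_succ', Equiv.Perm.mul_apply, coe_finRotate_of_ne_last, ih (by omega)]
    intro h
    have := congrArg Fin.val h
    rw [ih (by omega), Fin.val_last] at this
    omega

theorem isCycleOn_finRotate {m : ℕ} (hm : 2 ≤ m) : (finRotate m).IsCycleOn Set.univ := by
  have h := (isCycle_finRotate_of_le hm).isCycleOn
  have hs : {x | finRotate m x ≠ x} = Set.univ := by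
    rw [← Equiv.Perm.coe_support_eq_set_support, support_finRotate_of_le hm, Finset.coe_univ]
  rwa [hs] at h

theorem isIncr_finRotate {m : ℕ} (hm : 2 ≤ m) : IsIncr (finRotate m) := by
  obtain ⟨k, rfl⟩ : ∃ k, m = k + 1 := ⟨m - 1, by omega⟩
  intro a ha r s hrs hs
  have ha0 : a = 0 := le_antisymm
    (mem_cycleMins.1 ha 0 ((isCycleOn_finRotate hm).2 (Set.mem_univ _) (Set.mem_univ _)))
    (Fin.zero_le _)
  subst ha0
  have hlen : cycleLen (finRotate (k + 1)) 0 ≤ k + 1 :=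
    (Finset.card_le_univ _).trans (Fintype.card_fin _).le
  rw [Fin.lt_def, finRotate_pow_zero k r (by omega), finRotate_pow_zero k s (by omega)]
  exact hrs

/-- Both permutations have increasing cycles and the same one-block cycle partition, so `IsIncr.ext`
applies. -/
theorem IsIncr.eq_finRotate {m : ℕ} (hm : 2 ≤ m) {σ : Equiv.Perm (Fin m)} (h : IsIncr σ)
    (hc : σ.IsCycleOn Set.univ) : σ = finRotate m :=
  h.ext (isIncr_finRotate hm) fun _ _ =>
    iff_of_true (hc.2 (Set.mem_univ _) (Set.mem_univ _))
      ((isCycleOn_finRotate hm).2 (Set.mem_univ _) (Set.mem_univ _))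

end Avoidance

/-! ### The generating functions. -/

section Series

variable {R : Type*} [CommRing R]

theorem mem_CAS {n : ℕ} {τ : Equiv.Perm (Fin 3)} {σ : Equiv.Perm (Fin n)} :
    σ ∈ CAS n τ ↔ CycleAvoids τ σ := by simp [CAS]

theorem sum_CAS_incr {τ : Equiv.Perm (Fin 3)}
    (hτ : τ ∈ ({p132, p213, p321} : Set (Equiv.Perm (Fin 3)))) (g : ℕ → R) (n : ℕ) :
    ∑ σ ∈ CAS n τ, ∏ a ∈ cycleMins σ, g (cycleLen σ a) =
      partitionWeight g (Finset.univ : Finset (Fin n)) := by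
  classical
  rw [← sum_isIncr]
  refine Finset.sum_congr ?_ fun _ _ => rfl
  ext σ
  simp [mem_CAS, cycleAvoids_iff_isIncr hτ]

theorem sum_CAS_decr {τ : Equiv.Perm (Fin 3)}
    (hτ : τ ∈ ({p123, p312, p231} : Set (Equiv.Perm (Fin 3)))) (g : ℕ → R) (n : ℕ) :
    ∑ σ ∈ CAS n τ, ∏ a ∈ cycleMins σ, g (cycleLen σ a) =
      partitionWeight g (Finset.univ : Finset (Fin n)) := by
  classical
  rw [← sum_isDecr]
  refine Finset.sum_congr ?_ fun _ _ => rfl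
  ext σ
  simp [mem_CAS, cycleAvoids_iff_isDecr hτ]

theorem sum_CAS (τ : Equiv.Perm (Fin 3)) (g : ℕ → R) (n : ℕ) :
    ∑ σ ∈ CAS n τ, ∏ a ∈ cycleMins σ, g (cycleLen σ a) =
      partitionWeight g (Finset.univ : Finset (Fin n)) :=
  (mem_even_or_mem_odd τ).elim (fun h => sum_CAS_decr h g n) fun h => sum_CAS_incr h g n

variable [Algebra ℚ R]

theorem mk_partitionWeight (g : ℕ → R) :
    (PowerSeries.mk fun n => if n = 0 then 1 else algebraMap ℚ R (1 / (n.factorial : ℚ)) *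
      partitionWeight g (Finset.univ : Finset (Fin n))) = expOf (blockSeries g) := by
  have key : ∀ n : ℕ, algebraMap ℚ R (1 / (n.factorial : ℚ)) *
      partitionWeight g (Finset.univ : Finset (Fin n)) = coeff n (expOf (blockSeries g)) := by
    intro n
    have h : (n.factorial : ℚ) ≠ 0 := by positivity
    rw [partitionWeight_eq, Finset.card_univ, Fintype.card_fin, ← mul_assoc,
      ← map_natCast (algebraMap ℚ R), ← map_mul, one_div_mul_cancel h, map_one, one_mul]
  ext n
  rw [coeff_mk, key]
  split_ifs with hn
  -- The prescribed constant term 1 agrees with the weight of the single partition of the empty set.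
  · subst hn
    rw [← key, Finset.univ_eq_empty, partitionWeight_empty]
    simp
  · rfl

theorem blockSeries_const (c : R) :
    blockSeries (fun _ => c) = C c * (PowerSeries.exp R - 1) := by
  ext k
  rw [blockSeries, coeff_mk, coeff_C_mul, map_sub, coeff_exp, coeff_one]
  split_ifs with hk
  · subst hk; simp
  · ring

theorem CA2_eq (τ : Equiv.Perm (Fin 3)) (x : R) :
    CA2 τ x = expOf (C x * (PowerSeries.exp R - 1)) := by
  rw [← blockSeries_const, ← mk_partitionWeight, CA2]
  simp only [← sum_CAS τ, Finset.prod_const, cyc]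

theorem CA1_eq (τ : Equiv.Perm (Fin 3)) : CA1 R τ = expOf (PowerSeries.exp R - 1) := by
  have h := CA2_eq τ (1 : R)
  rw [map_one, one_mul] at h
  rw [← h, CA1, CA2]
  simp only [one_pow, Finset.sum_const, nsmul_eq_mul, mul_one]

theorem CA3_eq_of_odd {τ : Equiv.Perm (Fin 3)}
    (hτ : τ ∈ ({p132, p213, p321} : Set (Equiv.Perm (Fin 3)))) (x y : R) :
    CA3 τ x y = expOf (C x * C y * (PowerSeries.exp R - 1)) := by
  rw [← map_mul, ← blockSeries_const, ← mk_partitionWeight, CA3]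
  have key : ∀ n, ∑ σ ∈ CAS n τ, x ^ cyc σ * y ^ cdes σ =
      partitionWeight (fun _ => x * y)
        (Finset.univ : Finset (Fin n)) := by
    intro n
    rw [← sum_CAS_incr hτ]
    refine Finset.sum_congr rfl fun σ hσ => ?_
    rw [pow_cyc_mul_pow_cdes]
    refine Finset.prod_congr rfl fun a ha => ?_
    rw [((cycleAvoids_iff_isIncr hτ σ).1 (mem_CAS.1 hσ)).cdesCycle_eq ha, pow_one]
  simp only [key]

theorem expOf_C_mul_X (y : R) :
    expOf (C y * X) = PowerSeries.mk fun k => y ^ k * algebraMap ℚ R (1 / (k.factorial : ℚ)) := by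
  ext k
  rw [expOf, ← smul_eq_C_mul, ← rescale_eq_subst, coeff_rescale, coeff_exp, coeff_mk]

/-- For `k ≥ 2` one has `y ^ (k - 1) = y⁻¹ * y ^ k`, which is where invertibility of `y` enters.
Size 1 is exceptional and gives the separate term `y t`. -/
theorem blockSeries_decr (x : R) (y : Rˣ) :
    blockSeries (fun k => x * (y : R) ^ (if k = 1 then 1 else k - 1)) =
      C x * (C (y : R) * X + C ((y⁻¹ : Rˣ) : R) *
        (expOf (C (y : R) * X) - 1 - C (y : R) * X)) := by
  ext k
  rw [blockSeries, coeff_mk, coeff_C_mul, map_add, coeff_C_mul, coeff_C_mul, map_sub, map_sub,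
    expOf_C_mul_X, coeff_mk, coeff_C_mul, coeff_X, coeff_one]
  rcases k with _ | _ | k
  · simp
  · simp
  · have h : (y : R) ^ (k + 2) = y * (y : R) ^ (k + 1) := pow_succ' _ _
    have h' : (((y⁻¹ : Rˣ) : R)) * y = 1 := y.inv_mul
    simp only [Nat.add_eq_zero_iff, and_false, if_false, Nat.add_assoc, Nat.reduceAdd,
      OfNat.ofNat_ne_zero, show k + 2 ≠ 1 by omega, show k + 2 - 1 = k + 1 by omega, h]
    linear_combination (-x * (y : R) ^ (k + 1) *
      algebraMap ℚ R (1 / ((k + 2).factorial : ℚ))) * h'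

theorem CA3_eq_of_even {τ : Equiv.Perm (Fin 3)}
    (hτ : τ ∈ ({p123, p312, p231} : Set (Equiv.Perm (Fin 3)))) (x : R) (y : Rˣ) :
    CA3 τ x (y : R) = expOf (C x * (C (y : R) * X + C ((y⁻¹ : Rˣ) : R) *
        (expOf (C (y : R) * X) - 1 - C (y : R) * X))) := by
  rw [← blockSeries_decr, ← mk_partitionWeight, CA3]
  have key : ∀ n, ∑ σ ∈ CAS n τ, x ^ cyc σ * (y : R) ^ cdes σ =
      partitionWeight (fun k => x * (y : R) ^ (if k = 1 then 1 else k - 1))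
        (Finset.univ : Finset (Fin n)) := by
    intro n
    rw [← sum_CAS_decr hτ]
    refine Finset.sum_congr rfl fun σ hσ => ?_
    rw [pow_cyc_mul_pow_cdes]
    refine Finset.prod_congr rfl fun a ha => ?_
    rw [((cycleAvoids_iff_isDecr hτ σ).1 (mem_CAS.1 hσ)).cdesCycle_eq ha]
  simp only [key]

end Series

end CyclePattern

theorem mainTheorem10 (R : Type*) [CommRing R] [Algebra ℚ R] :
    (∀ τ : Equiv.Perm (Fin 3),
      CyclePattern.CA1 R τ = CyclePattern.expOf (PowerSeries.exp R - 1)) ∧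
    (∀ (τ : Equiv.Perm (Fin 3)) (x : R),
      CyclePattern.CA2 τ x =
        CyclePattern.expOf (PowerSeries.C x * (PowerSeries.exp R - 1))) ∧
    (∀ τ ∈ ({CyclePattern.p123, CyclePattern.p312, CyclePattern.p231} :
        Set (Equiv.Perm (Fin 3))), ∀ (x : R) (y : Rˣ),
      CyclePattern.CA3 τ x (y : R) =
        CyclePattern.expOf (PowerSeries.C x *
          (PowerSeries.C (y : R) * PowerSeries.X +
            PowerSeries.C ((y⁻¹ : Rˣ) : R) *
              (CyclePattern.expOf (PowerSeries.C (y : R) * PowerSeries.X) - 1 -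
                PowerSeries.C (y : R) * PowerSeries.X)))) ∧
    (∀ τ ∈ ({CyclePattern.p132, CyclePattern.p213, CyclePattern.p321} :
        Set (Equiv.Perm (Fin 3))), ∀ x y : R,
      CyclePattern.CA3 τ x y =
        CyclePattern.expOf (PowerSeries.C x * PowerSeries.C y * (PowerSeries.exp R - 1))) ∧
    (∀ m : ℕ, 3 ≤ m →
      (∀ τ ∈ ({CyclePattern.p123, CyclePattern.p312, CyclePattern.p231} :
          Set (Equiv.Perm (Fin 3))),
        {σ : Equiv.Perm (Fin m) | σ.IsCycleOn Set.univ ∧ CyclePattern.CycleAvoids τ σ} =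
          {(finRotate m)⁻¹}) ∧
      (∀ τ ∈ ({CyclePattern.p132, CyclePattern.p213, CyclePattern.p321} :
          Set (Equiv.Perm (Fin 3))),
        {σ : Equiv.Perm (Fin m) | σ.IsCycleOn Set.univ ∧ CyclePattern.CycleAvoids τ σ} =
          {finRotate m})) := by
  refine ⟨CyclePattern.CA1_eq, CyclePattern.CA2_eq, fun τ hτ => CyclePattern.CA3_eq_of_even hτ,
    fun τ hτ => CyclePattern.CA3_eq_of_odd hτ, fun m hm => ⟨fun τ hτ => ?_, fun τ hτ => ?_⟩⟩
  · ext σ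
    -- Passing to `σ⁻¹` reduces the decreasing case to uniqueness of the increasing full cycle.
    rw [Set.mem_ofPred_eq, CyclePattern.cycleAvoids_iff_isDecr hτ, ← CyclePattern.isIncr_inv,
      Set.mem_singleton_iff, ← Equiv.Perm.isCycleOn_inv]
    constructor
    · rintro ⟨hc, hi⟩
      rw [← hi.eq_finRotate (by omega) hc, inv_inv]
    · rintro rfl
      rw [inv_inv]
      exact ⟨CyclePattern.isCycleOn_finRotate (by omega),
        CyclePattern.isIncr_finRotate (by omega)⟩
  · ext σ
    rw [Set.mem_ofPred_eq, CyclePattern.cycleAvoids_iff_isIncr hτ, Set.mem_singleton_iff]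
    constructor
    · rintro ⟨hc, hi⟩
      exact hi.eq_finRotate (by omega) hc
    · rintro rfl
      exact ⟨CyclePattern.isCycleOn_finRotate (by omega),
        CyclePattern.isIncr_finRotate (by omega)⟩
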